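/- Let $a,b$ be relatively prime integers, and define the first and second Lucas sequences by $U_0=0$, $U_1=1$, $U_{k+2}=aU_{k+1}+bU_k$ and $V_0=2$, $V_1=a$, $V_{k+2}=aV_{k+1}+bV_k$ for $k\ge 0$. Assume that the pair $(a,b)$ is non-degenerate, that is, $b\neq 0$ and the ratio $\alpha/\beta$ of the two roots of $x^2-ax-b$ is not a root of unity, and that $a>0$ and $\Delta=a^2+4b>0$. For a positive integer $N$ relatively prime to $b$, let $\tau(N)$, the order of appearance of $N$, be the smallest integer $k\ge 1$ with $N\mid U_k$. Let $m,n\ge 3$ be integers, let $d=\gcd(m,n)$, let $[m,n]$ be the least common multiple of $m$ and $n$, and let $\nu_2$ denote the $2$-adic valuation. Then $U_mV_n$, $U_mU_n$ and $V_mV_n$ are positive and relatively prime to $b$, and the following hold. (i) $\tau(U_mV_n)=2[m,n]$ if $\nu_2(m)\le\nu_2(n)$, and $\tau(U_mV_n)=[m,n]\,V_d$ if $\nu_2(m)>\nu_2(n)$. (ii) $\tau(U_mU_n)=[m,n]\,U_d$. (iii) $\tau(V_mV_n)=[m,n]\gcd(V_m,V_n)$ if one of the following holds: $2\nmid b$,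 $2\mid a$ and $2\mid d$; or $2\nmid b$, $2\nmid a$ and $3\mid d$; or $2\nmid b$, $2\mid a$, $2\nmid d$ and $\nu_2(m)\ne\nu_2(n)$. And $\tau(V_mV_n)=2[m,n]\gcd(V_m,V_n)$ if one of the following holds: $2\mid b$; or $2\nmid b$, $2\nmid a$ and $3\nmid d$; or $2\nmid b$, $2\mid a$, $2\nmid d$ and $\nu_2(m)=\nu_2(n)$. -/

import Mathlib

namespace LucasPair

/-- The first Lucas sequence `U_n(a,b)`. -/
def U (a b : ℤ) : ℕ → ℤ
  | 0 => 0
  | 1 => 1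
  | n + 2 => a * U a b (n + 1) + b * U a b n

/-- The second Lucas sequence `V_n(a,b)`. -/
def V (a b : ℤ) : ℕ → ℤ
  | 0 => 2
  | 1 => a
  | n + 2 => a * V a b (n + 1) + b * V a b n

/-- The pair `(a,b)` is non-degenerate: `b ≠ 0` and, whenever `α, β` are the two complex roots
(with multiplicity) of `x² - a x - b`, the ratio `α/β` is not a root of unity. -/
def Nondegenerate (a b : ℤ) : Prop :=
  b ≠ 0 ∧ ∀ α β : ℂ, α + β = (a : ℂ) → α * β = -(b : ℂ) → ∀ k : ℕ, 1 ≤ k → (α / β) ^ k ≠ 1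

/-- The integers whose order of appearance is defined: positive and relatively prime to `b`. -/
def Admissible (b N : ℤ) : Prop := 0 < N ∧ IsCoprime N b

/-- The order of appearance of `N` in `(U_n(a,b))`: the smallest `k ≥ 1` with `N ∣ U_k`.
The value is `0` exactly when there is no such `k`. -/
noncomputable def tau (a b N : ℤ) : ℕ := sInf {k : ℕ | 1 ≤ k ∧ N ∣ U a b k}

end LucasPair

/-!
For `D ∣ U_m` the quotient `U_{mk} / U_m` is a unit times `k` modulo `D`: it is the `k`-th term of
the first Lucas sequence of `x² - V_m x + (-b)^m`, whose discriminant `Δ U_m²` vanishes modulo `D`.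
It follows that if `L` is the least common multiple of `τ(A)` and `τ(B)`, and `U_L = A x = B y`,
then `τ(AB) gcd(A, B, x, y) = L gcd(A, B)`. Since `τ(U_m) = m` and `τ(V_n) = 2n`, it remains to find
the defect `gcd(A, B, x, y)`. It is `1` for `U_m U_n`, and for `U_m V_n` when `ν₂(m) > ν₂(n)`. For
`V_m V_n` it divides `2`, because `gcd(U_k, V_k)` does, and its value depends on the parity of the
terms of the two sequences. If `ν₂(m) ≤ ν₂(n)`, then `U_m V_n` divides
`U_{[m,n]} V_{[m,n]} = U_{2[m,n]}`, which is already the term at `L = lcm(m, 2n)`.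
-/

namespace LucasPair

section Arithmetic

lemma dvd_mul_iff_right_of_isCoprime {R : Type*} [CommSemiring R] {x y z : R}
    (h : IsCoprime x y) : x ∣ y * z ↔ x ∣ z :=
  ⟨h.dvd_of_dvd_mul_left, fun hz => hz.mul_left y⟩

lemma dvd_mul_iff_left_of_isCoprime {R : Type*} [CommSemiring R] {x y z : R}
    (h : IsCoprime x z) : x ∣ y * z ↔ x ∣ y :=
  ⟨h.dvd_of_dvd_mul_right, fun hy => hy.mul_right z⟩

lemma exists_coprime_mul {m n : ℕ} (hm : 0 < m) (hn : 0 < n) :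
    ∃ d r s, 0 < d ∧ 0 < r ∧ 0 < s ∧ r.Coprime s ∧ m = d * r ∧ n = d * s := by
  obtain ⟨r, s, hrs, hr, hs⟩ := Nat.exists_coprime m n
  refine ⟨m.gcd n, r, s, Nat.gcd_pos_of_pos_left n hm, Nat.pos_of_mul_pos_right (hr ▸ hm),
    Nat.pos_of_mul_pos_right (hs ▸ hn), hrs, ?_, ?_⟩
  · rwa [mul_comm]
  · rwa [mul_comm]

lemma lcm_mul_mul_of_coprime {r s : ℕ} (hrs : r.Coprime s) (d : ℕ) :
    (d * r).lcm (d * s) = d * r * s := by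
  rw [Nat.lcm_mul_left, hrs.lcm_eq_mul, mul_assoc]

lemma coprime_lcm_div_lcm_div {m n : ℕ} (hm : 0 < m) (hn : 0 < n) :
    (m.lcm n / m).Coprime (m.lcm n / n) := by
  obtain ⟨d, r, s, -, -, -, hrs, rfl, rfl⟩ := exists_coprime_mul hm hn
  rw [lcm_mul_mul_of_coprime hrs, Nat.mul_div_cancel_left _ hm, mul_right_comm,
    Nat.mul_div_cancel_left _ hn]
  exact hrs.symm

lemma padicValNat_mul_le_mul_iff {p : ℕ} [hp : Fact p.Prime] {d r s : ℕ} (hd : 0 < d)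
    (hr : 0 < r) (hs : 0 < s) (hrs : r.Coprime s) :
    padicValNat p (d * r) ≤ padicValNat p (d * s) ↔ ¬ p ∣ r := by
  rw [padicValNat.mul hd.ne' hr.ne', padicValNat.mul hd.ne' hs.ne', add_le_add_iff_left]
  refine ⟨fun hle hpr => ?_, fun hpr => ?_⟩
  · have hps : ¬ p ∣ s := fun hps => hp.out.one_lt.ne' (Nat.eq_one_of_dvd_coprimes hrs hpr hps)
    rw [padicValNat.eq_zero_of_not_dvd hps] at hle
    exact (dvd_iff_padicValNat_ne_zero hr.ne').1 hpr (Nat.le_zero.1 hle)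
  · exact (padicValNat.eq_zero_of_not_dvd hpr).trans_le (Nat.zero_le _)

lemma exists_coprime_mul_of_padicValNat_two_le {m n : ℕ} (hm : 0 < m) (hn : 0 < n)
    (h : padicValNat 2 m ≤ padicValNat 2 n) :
    ∃ d r s, 0 < d ∧ Odd r ∧ r.Coprime s ∧ m = d * r ∧ n = d * s := by
  obtain ⟨d, r, s, hd, hr, hs, hrs, rfl, rfl⟩ := exists_coprime_mul hm hn
  rw [padicValNat_mul_le_mul_iff hd hr hs hrs, ← even_iff_two_dvd, Nat.not_even_iff_odd] at h
  exact ⟨d, r, s, hd, h, hrs, rfl, rfl⟩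

lemma exists_coprime_mul_of_padicValNat_two_lt {m n : ℕ} (hm : 0 < m) (hn : 0 < n)
    (h : padicValNat 2 n < padicValNat 2 m) :
    ∃ d r s, 0 < d ∧ (2 * r).Coprime s ∧ m = d * (2 * r) ∧ n = d * s := by
  obtain ⟨d, r, s, hd, hr, hs, hrs, rfl, rfl⟩ := exists_coprime_mul hm hn
  rw [← not_le, padicValNat_mul_le_mul_iff hd hr hs hrs, not_not] at h
  obtain ⟨t, rfl⟩ := h
  exact ⟨d, t, s, hd, hrs, rfl, rfl⟩

lemma lcm_two_mul_of_padicValNat_le {m n : ℕ} (hm : 0 < m) (hn : 0 < n)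
    (h : padicValNat 2 m ≤ padicValNat 2 n) : m.lcm (2 * n) = 2 * m.lcm n := by
  obtain ⟨d, r, s, -, hr, hrs, rfl, rfl⟩ := exists_coprime_mul_of_padicValNat_two_le hm hn h
  rw [lcm_mul_mul_of_coprime hrs, mul_left_comm 2 d s,
    lcm_mul_mul_of_coprime ((Nat.coprime_two_right.2 hr).mul_right hrs)]
  ring

lemma lcm_two_mul_of_padicValNat_lt {m n : ℕ} (hm : 0 < m) (hn : 0 < n)
    (h : padicValNat 2 n < padicValNat 2 m) : m.lcm (2 * n) = m.lcm n := by
  obtain ⟨d, r, s, -, hrs, rfl, rfl⟩ := exists_coprime_mul_of_padicValNat_two_lt hm hn h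
  rw [lcm_mul_mul_of_coprime hrs, mul_left_comm d, Nat.lcm_mul_left,
    lcm_mul_mul_of_coprime hrs.coprime_mul_left]
  ring

lemma prime_dvd_lcm_iff {p : ℕ} [hp : Fact p.Prime] {m n : ℕ} (hm : m ≠ 0) (hn : n ≠ 0) :
    p ∣ m.lcm n ↔ p ∣ m.gcd n ∨ padicValNat p m ≠ padicValNat p n := by
  rw [hp.out.dvd_lcm, Nat.dvd_gcd_iff, dvd_iff_padicValNat_ne_zero hm,
    dvd_iff_padicValNat_ne_zero hn]
  omega

/-- Both sides are `gcd (A W, B W)` for `W = A x = B y`. -/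
lemma natAbs_mul_gcd_eq_natAbs_mul_gcd {A B x y W : ℤ} (hx : W = A * x) (hy : W = B * y) :
    W.natAbs * Int.gcd A B = (A * B).natAbs * Int.gcd x y := by
  rw [← Int.gcd_mul_left, ← Int.gcd_mul_left, Int.gcd_comm (A * B * x)]
  congr 1
  · rw [hy]; ring
  · rw [hx]; ring

lemma mul_dvd_mul_iff_div_gcd_dvd {A B x y W : ℤ} (hW : W ≠ 0) (hx : W = A * x) (hy : W = B * y)
    (X : ℤ) : A * B ∣ W * X ↔
      ((Int.gcd A B / (Int.gcd (Int.gcd A B) (Int.gcd x y)) : ℕ) : ℤ) ∣ X := by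
  have hA : A ≠ 0 := left_ne_zero_of_mul (hx ▸ hW)
  have hB : B ≠ 0 := left_ne_zero_of_mul (hy ▸ hW)
  have hg : 0 < Int.gcd A B := Int.gcd_pos_of_ne_zero_left _ hA
  have hAB : 0 < (A * B).natAbs := Int.natAbs_pos.2 (mul_ne_zero hA hB)
  have key := natAbs_mul_gcd_eq_natAbs_mul_gcd hx hy
  set g := Int.gcd A B
  set q := Int.gcd x y
  rw [Int.gcd_natCast_natCast, Int.natCast_dvd, ← Int.natAbs_dvd_natAbs, Int.natAbs_mul W X]
  calc (A * B).natAbs ∣ W.natAbs * X.natAbs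
      ↔ g * (A * B).natAbs ∣ g * (W.natAbs * X.natAbs) := (Nat.mul_dvd_mul_iff_left hg).symm
    _ ↔ (A * B).natAbs * g ∣ (A * B).natAbs * (q * X.natAbs) := by
      rw [mul_comm g, ← mul_assoc g, mul_comm g W.natAbs, key, mul_assoc]
    _ ↔ g ∣ g.gcd q * X.natAbs := by
      rw [Nat.mul_dvd_mul_iff_left hAB, Nat.dvd_gcd_mul_iff_dvd_mul]
    _ ↔ g / g.gcd q ∣ X.natAbs := by
      rw [Nat.div_dvd_iff_dvd_mul (Nat.gcd_dvd_left g q) (Nat.gcd_pos_of_pos_left q hg)]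

end Arithmetic

section Identities

variable (a b : ℤ)

lemma U_add_two (n : ℕ) : U a b (n + 2) = a * U a b (n + 1) + b * U a b n := rfl

lemma V_add_two (n : ℕ) : V a b (n + 2) = a * V a b (n + 1) + b * V a b n := rfl

lemma V_eq (n : ℕ) : V a b n = 2 * U a b (n + 1) - a * U a b n := by
  induction n using Nat.twoStepInduction with
  | zero => simp [U, V]
  | one => simp [U, V]; ring
  | more n h₁ h₂ =>
    rw [V_add_two, h₁, h₂, U_add_two a b (n + 1), U_add_two a b n]; ring

lemma two_mul_V_succ (n : ℕ) :
    2 * V a b (n + 1) = (a ^ 2 + 4 * b) * U a b n + a * V a b n := by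
  rw [V_eq, V_eq, U_add_two]; ring

lemma U_add_add_one (m n : ℕ) :
    U a b (m + n + 1) = U a b (m + 1) * U a b (n + 1) + b * U a b m * U a b n := by
  induction n using Nat.twoStepInduction with
  | zero => simp [U]
  | one => simp [U]; ring
  | more n h₁ h₂ =>
    calc U a b (m + (n + 2) + 1)
        = a * U a b (m + (n + 1) + 1) + b * U a b (m + n + 1) := U_add_two ..
      _ = U a b (m + 1) * U a b (n + 2 + 1) + b * U a b m * U a b (n + 2) := by
        rw [h₁, h₂, U_add_two a b (n + 1), U_add_two a b n]; ring

lemma U_add (m n : ℕ) :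
    U a b (m + n) =
      U a b m * U a b (n + 1) + U a b (m + 1) * U a b n - a * U a b m * U a b n := by
  cases n with
  | zero => simp [U]
  | succ n => rw [← add_assoc, U_add_add_one, U_add_two]; ring

lemma U_cassini (n : ℕ) :
    U a b (n + 1) ^ 2 - a * U a b (n + 1) * U a b n - b * U a b n ^ 2 = (-b) ^ n := by
  induction n with
  | zero => simp [U]
  | succ n ih => rw [U_add_two, pow_succ (-b), ← ih]; ring

lemma U_two_mul (n : ℕ) : U a b (2 * n) = U a b n * V a b n := by
  rw [two_mul, U_add, V_eq]; ring

lemma V_sq (n : ℕ) : V a b n ^ 2 = (a ^ 2 + 4 * b) * U a b n ^ 2 + 4 * (-b) ^ n := by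
  rw [V_eq, ← U_cassini]; ring

lemma U_add_two_mul (n d : ℕ) :
    U a b (n + 2 * d) = V a b d * U a b (n + d) - (-b) ^ d * U a b n := by
  rw [V_eq, ← U_cassini a b d, two_mul d, ← add_assoc, U_add a b (n + d) d,
    U_add_add_one a b n d, U_add a b n d]
  ring

lemma V_add_two_mul (n d : ℕ) :
    V a b (n + 2 * d) =
      (-b) ^ d * V a b n + (a ^ 2 + 4 * b) * U a b (n + d) * U a b d := by
  rw [V_eq a b (n + 2 * d), V_eq a b n, ← U_cassini a b d, two_mul d, ← add_assoc,
    U_add_add_one a b (n + d) d, U_add a b (n + d) d, U_add_add_one a b n d, U_add a b n d]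
  ring

/-- The quotient `U_{mk} / U_m`. It is itself a term of a first Lucas sequence, whose parameters
`α^m + β^m = V_m` and `-(αβ)^m = -(-b)^m` belong to the `m`-th powers of the roots `α, β` of
`x² - a x - b`; as a definition this makes sense also when `U_m = 0`. -/
def UQuot (m k : ℕ) : ℤ := U (V a b m) (-(-b) ^ m) k

lemma U_mul (m k : ℕ) : U a b (m * k) = U a b m * UQuot a b m k := by
  induction k using Nat.twoStepInduction with
  | zero => simp [UQuot, U]
  | one => simp [UQuot, U]
  | more k h₁ h₂ =>
    simp only [UQuot] at *
    rw [show m * (k + 2) = m * k + 2 * m by ring, U_add_two_mul, ← Nat.mul_succ, h₁, h₂,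
      U_add_two]
    ring

lemma U_dvd_U_of_dvd {m n : ℕ} (h : m ∣ n) : U a b m ∣ U a b n := by
  obtain ⟨k, rfl⟩ := h
  exact ⟨_, U_mul a b m k⟩

lemma V_dvd_U_two_mul (n : ℕ) : V a b n ∣ U a b (2 * n) :=
  ⟨U a b n, by rw [U_two_mul, mul_comm]⟩

lemma U_two_mul_mul (n k : ℕ) :
    U a b (2 * n * k) = V a b n * (U a b n * UQuot a b (2 * n) k) := by
  rw [U_mul, U_two_mul]; ring

end Identities

variable {a b : ℤ}

section Divisibility

lemma isCoprime_U_right (hab : IsCoprime a b) {n : ℕ} (hn : 0 < n) : IsCoprime (U a b n) b := by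
  induction n, hn using Nat.le_induction with
  | base => exact isCoprime_one_left
  | succ n hn ih =>
    obtain ⟨k, rfl⟩ := Nat.exists_eq_add_of_le' hn
    rw [U_add_two]
    exact (hab.mul_left ih).add_mul_left_left _

lemma isCoprime_V_right (hab : IsCoprime a b) {n : ℕ} (hn : 0 < n) : IsCoprime (V a b n) b := by
  induction n, hn using Nat.le_induction with
  | base => exact hab
  | succ n hn ih =>
    obtain ⟨k, rfl⟩ := Nat.exists_eq_add_of_le' hn
    rw [V_add_two]
    exact (hab.mul_left ih).add_mul_left_left _

lemma isCoprime_U_U_succ (hab : IsCoprime a b) (n : ℕ) :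
    IsCoprime (U a b n) (U a b (n + 1)) := by
  induction n with
  | zero => exact isCoprime_one_right
  | succ n ih =>
    rw [U_add_two, add_comm (a * _), mul_comm a]
    exact ((isCoprime_U_right hab n.succ_pos).mul_right ih.symm).add_mul_left_right _

lemma dvd_U_add_iff (hab : IsCoprime a b) {D : ℤ} {m : ℕ} (hD : D ∣ U a b m) (n : ℕ) :
    D ∣ U a b (m + n) ↔ D ∣ U a b n := by
  have hcop : IsCoprime D (U a b (m + 1)) :=
    (isCoprime_U_U_succ hab m).of_isCoprime_of_dvd_left hD
  have key : U a b (m + n) =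
      U a b (m + 1) * U a b n + U a b m * (U a b (n + 1) - a * U a b n) := by
    rw [U_add]; ring
  rw [key, dvd_add_left (hD.mul_right _), dvd_mul_iff_right_of_isCoprime hcop]

lemma dvd_U_mod_iff (hab : IsCoprime a b) {D : ℤ} {m : ℕ} (hD : D ∣ U a b m) (n : ℕ) :
    D ∣ U a b (n % m) ↔ D ∣ U a b n := by
  conv_rhs => rw [← Nat.div_add_mod n m]
  exact (dvd_U_add_iff hab (hD.trans (U_dvd_U_of_dvd a b (dvd_mul_right _ _))) _).symm

lemma dvd_U_gcd_iff (hab : IsCoprime a b) {D : ℤ} (m n : ℕ) :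
    D ∣ U a b (m.gcd n) ↔ D ∣ U a b m ∧ D ∣ U a b n := by
  induction m, n using Nat.gcd.induction with
  | H0 n => simp [U]
  | H1 m n _ ih =>
    rw [Nat.gcd_rec, ih, and_comm]
    exact and_congr_right fun hD => dvd_U_mod_iff hab hD n

lemma gcd_U_U (hab : IsCoprime a b) (m n : ℕ) :
    Int.gcd (U a b m) (U a b n) = (U a b (m.gcd n)).natAbs := by
  refine eq_of_forall_dvd' fun k => ?_
  rw [← Int.natCast_dvd, dvd_U_gcd_iff hab, Int.dvd_gcd_iff]

lemma dvd_U_iff_prime_dvd (hab : IsCoprime a b) {D : ℤ} (hD : ¬ IsUnit D) {q : ℕ}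
    (hq : q.Prime) (hDq : D ∣ U a b q) (k : ℕ) : D ∣ U a b k ↔ q ∣ k := by
  refine ⟨fun hk => by_contra fun hqk => hD ?_, fun h => hDq.trans (U_dvd_U_of_dvd a b h)⟩
  have h := (dvd_U_gcd_iff hab q k).2 ⟨hDq, hk⟩
  rw [(hq.coprime_iff_not_dvd.2 hqk).gcd_eq_one] at h
  exact isUnit_of_dvd_one h

/-- If `x² - P x - Q ≡ (x - c)²` modulo `N`, then `U_k(P,Q) ≡ k c^(k-1)`; the extra factor `c`
avoids the exponent `k - 1`. -/
lemma U_mul_modEq_of_double_root {P Q c N : ℤ} (hP : P ≡ 2 * c [ZMOD N])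
    (hQ : Q ≡ -c ^ 2 [ZMOD N]) (k : ℕ) : U P Q k * c ≡ k * c ^ k [ZMOD N] := by
  induction k using Nat.twoStepInduction with
  | zero => simp [U]
  | one => simp [U]
  | more k h₁ h₂ =>
    calc U P Q (k + 2) * c = P * (U P Q (k + 1) * c) + Q * (U P Q k * c) := by
          rw [U_add_two]; ring
      _ ≡ 2 * c * ((k + 1 : ℕ) * c ^ (k + 1)) + -c ^ 2 * (k * c ^ k) [ZMOD N] :=
          (hP.mul h₂).add (hQ.mul h₁)
      _ = (k + 2 : ℕ) * c ^ (k + 2) := by push_cast; ring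

lemma UQuot_mul_modEq (m k : ℕ) :
    UQuot a b m k * U a b (m + 1) ≡ k * U a b (m + 1) ^ k [ZMOD U a b m] := by
  refine U_mul_modEq_of_double_root ?_ ?_ k
  · exact Int.modEq_iff_dvd.2 ⟨a, by rw [V_eq]; ring⟩
  · refine Int.modEq_iff_dvd.2 ⟨-(a * U a b (m + 1) + b * U a b m), ?_⟩
    linear_combination -U_cassini a b m

lemma dvd_mul_UQuot_iff (hab : IsCoprime a b) {D : ℤ} {m : ℕ} (hD : D ∣ U a b m) (c : ℤ)
    (k : ℕ) : D ∣ c * UQuot a b m k ↔ D ∣ c * k := by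
  have hcop : IsCoprime D (U a b (m + 1)) :=
    (isCoprime_U_U_succ hab m).of_isCoprime_of_dvd_left hD
  have hmod := ((UQuot_mul_modEq m k).of_dvd hD).mul_left c
  rw [← mul_assoc, ← mul_assoc] at hmod
  rw [← dvd_mul_iff_left_of_isCoprime hcop, hmod.dvd_iff,
    dvd_mul_iff_left_of_isCoprime hcop.pow_right]

lemma dvd_UQuot_iff (hab : IsCoprime a b) {D : ℤ} {m : ℕ} (hD : D ∣ U a b m) (k : ℕ) :
    D ∣ UQuot a b m k ↔ D ∣ k := by
  simpa only [one_mul] using dvd_mul_UQuot_iff hab hD 1 k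

/-- `U_n` and `V_n` generate an ideal containing `2`. -/
lemma dvd_two_mul_of_dvd_V (hab : IsCoprime a b) {D X : ℤ} {n : ℕ} (hV : D ∣ V a b n)
    (hU : D ∣ U a b n * X) : D ∣ 2 * X := by
  obtain ⟨p, q, hpq⟩ := isCoprime_U_U_succ hab n
  have key : 2 * X = (2 * p + a * q) * (U a b n * X) + q * X * V a b n := by
    rw [V_eq]; linear_combination (-2 * X) * hpq
  rw [key]
  exact dvd_add (hU.mul_left _) (hV.mul_left _)

lemma V_mul_odd_modEq (d i : ℕ) :
    V a b (d * (2 * i + 1)) ≡ (-b) ^ (d * i) * V a b d [ZMOD U a b (2 * d)] := by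
  induction i with
  | zero => simp
  | succ i ih =>
    have hU : U a b (2 * d) ∣ U a b (d * (2 * i + 1) + d) :=
      U_dvd_U_of_dvd a b ⟨i + 1, by ring⟩
    calc V a b (d * (2 * (i + 1) + 1))
        = (-b) ^ d * V a b (d * (2 * i + 1)) +
            (a ^ 2 + 4 * b) * U a b (d * (2 * i + 1) + d) * U a b d := by
          rw [← V_add_two_mul]; congr 1; ring
      _ ≡ (-b) ^ d * ((-b) ^ (d * i) * V a b d) + 0 [ZMOD U a b (2 * d)] :=
          (ih.mul_left _).add (Int.modEq_zero_iff_dvd.2 ((hU.mul_left _).mul_right _))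
      _ = (-b) ^ (d * (i + 1)) * V a b d := by ring

lemma dvd_V_mul_odd_iff (hab : IsCoprime a b) {D : ℤ} {d j : ℕ} (hd : 0 < d) (hj : Odd j)
    (hD : D ∣ U a b (2 * d)) : D ∣ V a b (d * j) ↔ D ∣ V a b d := by
  obtain ⟨i, rfl⟩ := hj
  have hcop : IsCoprime D b :=
    (isCoprime_U_right hab (Nat.mul_pos two_pos hd)).of_isCoprime_of_dvd_left hD
  rw [((V_mul_odd_modEq d i).of_dvd hD).dvd_iff,
    dvd_mul_iff_right_of_isCoprime hcop.neg_right.pow_right]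

lemma V_dvd_V_mul_odd (hab : IsCoprime a b) {d j : ℕ} (hd : 0 < d) (hj : Odd j) :
    V a b d ∣ V a b (d * j) :=
  (dvd_V_mul_odd_iff hab hd hj (V_dvd_U_two_mul a b d)).2 dvd_rfl

lemma V_dvd_V_of_padicValNat_le (hab : IsCoprime a b) {m n : ℕ} (hm : 0 < m) (hn : 0 < n)
    (h : padicValNat 2 m ≤ padicValNat 2 n) : V a b n ∣ V a b (m.lcm n) := by
  obtain ⟨d, r, s, -, hr, hrs, rfl, rfl⟩ := exists_coprime_mul_of_padicValNat_two_le hm hn h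
  rw [lcm_mul_mul_of_coprime hrs, mul_right_comm]
  exact V_dvd_V_mul_odd hab hn hr

lemma gcd_U_V_of_padicValNat_lt (hab : IsCoprime a b) {m n : ℕ} (hm : 0 < m) (hn : 0 < n)
    (h : padicValNat 2 n < padicValNat 2 m) :
    Int.gcd (U a b m) (V a b n) = (V a b (m.gcd n)).natAbs := by
  obtain ⟨d, r, s, hd, hrs, rfl, rfl⟩ := exists_coprime_mul_of_padicValNat_two_lt hm hn h
  have hs : Odd s := Nat.coprime_two_left.1 hrs.coprime_mul_right
  have hgcd : (d * (2 * r)).gcd (2 * (d * s)) = 2 * d := by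
    rw [mul_left_comm d, Nat.gcd_mul_left, Nat.gcd_mul_left, hrs.coprime_mul_left.gcd_eq_one,
      mul_one]
  rw [Nat.gcd_mul_left, hrs.gcd_eq_one, mul_one]
  refine eq_of_forall_dvd' fun k => ?_
  rw [← Int.natCast_dvd, Int.dvd_gcd_iff]
  refine ⟨fun ⟨hkU, hkV⟩ => ?_, fun hk => ?_⟩
  · refine (dvd_V_mul_odd_iff hab hd hs ?_).1 hkV
    rw [← hgcd, dvd_U_gcd_iff hab]
    exact ⟨hkU, hkV.trans (V_dvd_U_two_mul a b _)⟩
  · exact ⟨(hk.trans (V_dvd_U_two_mul a b d)).trans (U_dvd_U_of_dvd a b ⟨r, by ring⟩),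
      hk.trans (V_dvd_V_mul_odd hab hd hs)⟩

end Divisibility

section Growth

lemma U_nonneg_and_V_pos (ha : 0 < a) (hΔ : 0 < a ^ 2 + 4 * b) (n : ℕ) :
    0 ≤ U a b n ∧ 0 < V a b n := by
  induction n with
  | zero => simp [U, V]
  | succ n ih =>
    have hU := mul_nonneg ha.le ih.1
    have hV := mul_pos ha ih.2
    have hΔU := mul_nonneg hΔ.le ih.1
    constructor
    · linarith [V_eq a b n]
    · linarith [two_mul_V_succ a b n]

lemma V_pos (ha : 0 < a) (hΔ : 0 < a ^ 2 + 4 * b) (n : ℕ) : 0 < V a b n :=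
  (U_nonneg_and_V_pos ha hΔ n).2

lemma U_pos (ha : 0 < a) (hΔ : 0 < a ^ 2 + 4 * b) {n : ℕ} (hn : 0 < n) : 0 < U a b n := by
  obtain ⟨k, rfl⟩ := Nat.exists_eq_add_of_le' hn
  obtain ⟨hU, hV⟩ := U_nonneg_and_V_pos ha hΔ k
  linarith [V_eq a b k, mul_nonneg ha.le hU]

lemma U_succ_lt_U_add_two (ha : 0 < a) (hΔ : 0 < a ^ 2 + 4 * b) (hb : b ≠ 0) {n : ℕ}
    (hn : 0 < n) : U a b (n + 1) < U a b (n + 2) := by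
  have hUn := U_pos ha hΔ hn
  have hUn1 := U_pos ha hΔ n.succ_pos
  obtain rfl | ha2 : a = 1 ∨ 2 ≤ a := by omega
  · have hb1 : 1 ≤ b := by omega
    rw [U_add_two]
    linarith [mul_pos (zero_lt_one.trans_le hb1) hUn]
  · linarith [V_eq a b (n + 1), V_pos ha hΔ (n + 1), mul_le_mul_of_nonneg_right ha2 hUn1.le]

lemma U_lt_U (ha : 0 < a) (hΔ : 0 < a ^ 2 + 4 * b) (hb : b ≠ 0) {m n : ℕ} (hm : 0 < m)
    (hmn : m < n) (hn : 3 ≤ n) : U a b m < U a b n := by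
  have hmono : StrictMono fun k => U a b (k + 2) :=
    strictMono_nat_of_lt_succ fun k => U_succ_lt_U_add_two ha hΔ hb k.succ_pos
  obtain ⟨l, rfl⟩ := Nat.exists_eq_add_of_le' (show 2 ≤ n by omega)
  obtain rfl | hm2 : m = 1 ∨ 2 ≤ m := by omega
  · have h12 : U a b 1 ≤ U a b 2 := U_pos ha hΔ two_pos
    exact h12.trans_lt (hmono (show 0 < l by omega))
  · obtain ⟨k, rfl⟩ := Nat.exists_eq_add_of_le' hm2
    exact hmono (show k < l by omega)

lemma U_lt_V (ha : 0 < a) (hΔ : 0 < a ^ 2 + 4 * b) (hb : b ≠ 0) {n : ℕ} (hn : 3 ≤ n) :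
    U a b n < V a b n := by
  obtain ⟨k, rfl⟩ := Nat.exists_eq_add_of_le' hn
  have hU := U_pos ha hΔ (n := k + 3) (by omega)
  rcases hb.lt_or_gt with hb | hb
  · refine lt_of_pow_lt_pow_left₀ 2 (V_pos ha hΔ _).le ?_
    have hpow : 0 < (-b) ^ (k + 3) := pow_pos (neg_pos.2 hb) _
    rw [V_sq]
    linarith [mul_le_mul_of_nonneg_right (Int.add_one_le_of_lt hΔ) (sq_nonneg (U a b (k + 3)))]
  · have hUb := mul_pos hb (U_pos ha hΔ (n := k + 2) (by omega))
    rw [V_eq, U_add_two a b (k + 2)]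
    linarith [mul_le_mul_of_nonneg_right (Int.add_one_le_of_lt ha) hU.le]

lemma Admissible.mul {x y : ℤ} (hx : Admissible b x) (hy : Admissible b y) :
    Admissible b (x * y) :=
  ⟨mul_pos hx.1 hy.1, hx.2.mul_left hy.2⟩

lemma admissible_U (hab : IsCoprime a b) (ha : 0 < a) (hΔ : 0 < a ^ 2 + 4 * b) {n : ℕ}
    (hn : 0 < n) : Admissible b (U a b n) :=
  ⟨U_pos ha hΔ hn, isCoprime_U_right hab hn⟩

lemma admissible_V (hab : IsCoprime a b) (ha : 0 < a) (hΔ : 0 < a ^ 2 + 4 * b) {n : ℕ}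
    (hn : 0 < n) : Admissible b (V a b n) :=
  ⟨V_pos ha hΔ n, isCoprime_V_right hab hn⟩

end Growth

section OrderOfAppearance

lemma tau_eq_of_forall_dvd_iff {N : ℤ} {T : ℕ} (hT : 0 < T) (h : ∀ k, N ∣ U a b k ↔ T ∣ k) :
    tau a b N = T :=
  IsLeast.csInf_eq ⟨⟨hT, (h T).2 dvd_rfl⟩, fun k ⟨hk, hN⟩ => Nat.le_of_dvd hk ((h k).1 hN)⟩

lemma tau_le {N : ℤ} {k : ℕ} (hk : 0 < k) (h : N ∣ U a b k) : tau a b N ≤ k :=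
  Nat.sInf_le ⟨hk, h⟩

lemma tau_pos {N : ℤ} {k : ℕ} (hk : 0 < k) (h : N ∣ U a b k) : 0 < tau a b N :=
  (Nat.sInf_mem (s := {k : ℕ | 1 ≤ k ∧ N ∣ U a b k}) ⟨k, hk, h⟩).1

lemma tau_U_pos (a b : ℤ) {m : ℕ} (hm : 0 < m) : 0 < tau a b (U a b m) :=
  tau_pos hm dvd_rfl

lemma tau_V_pos (a b : ℤ) {n : ℕ} (hn : 0 < n) : 0 < tau a b (V a b n) :=
  tau_pos (Nat.mul_pos two_pos hn) (V_dvd_U_two_mul a b n)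

lemma dvd_U_tau {N : ℤ} (hN : 0 < tau a b N) : N ∣ U a b (tau a b N) :=
  (Nat.sInf_mem (Nat.nonempty_of_pos_sInf hN)).2

lemma dvd_U_iff_tau_dvd (hab : IsCoprime a b) {N : ℤ} (hN : 0 < tau a b N) (k : ℕ) :
    N ∣ U a b k ↔ tau a b N ∣ k := by
  refine ⟨fun hk => ?_, fun hk => (dvd_U_tau hN).trans (U_dvd_U_of_dvd a b hk)⟩
  have hgcd : N ∣ U a b ((tau a b N).gcd k) := (dvd_U_gcd_iff hab _ _).2 ⟨dvd_U_tau hN, hk⟩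
  have hle : tau a b N ≤ (tau a b N).gcd k := tau_le (Nat.gcd_pos_of_pos_left _ hN) hgcd
  exact Nat.gcd_eq_left_iff_dvd.1 ((Nat.gcd_le_left _ hN).antisymm hle)

lemma lcm_tau_dvd_of_mul_dvd (hab : IsCoprime a b) {A B : ℤ} (hA : 0 < tau a b A)
    (hB : 0 < tau a b B) {k : ℕ} (h : A * B ∣ U a b k) :
    (tau a b A).lcm (tau a b B) ∣ k :=
  Nat.lcm_dvd ((dvd_U_iff_tau_dvd hab hA k).1 (dvd_of_mul_right_dvd h))
    ((dvd_U_iff_tau_dvd hab hB k).1 (dvd_of_mul_left_dvd h))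

lemma tau_U (ha : 0 < a) (hΔ : 0 < a ^ 2 + 4 * b) (hb : b ≠ 0) {m : ℕ} (hm : 3 ≤ m) :
    tau a b (U a b m) = m := by
  have hm0 : 0 < m := by omega
  have hpos := tau_U_pos a b hm0
  refine (tau_le hm0 dvd_rfl).antisymm (not_lt.1 fun hlt => ?_)
  exact (U_lt_U ha hΔ hb hpos hlt hm).not_ge
    (Int.le_of_dvd (U_pos ha hΔ hpos) (dvd_U_tau hpos))

lemma tau_V (hab : IsCoprime a b) (ha : 0 < a) (hΔ : 0 < a ^ 2 + 4 * b) (hb : b ≠ 0) {n : ℕ}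
    (hn : 3 ≤ n) : tau a b (V a b n) = 2 * n := by
  have hpos := tau_V_pos a b (n := n) (by omega)
  have hlt : n < tau a b (V a b n) := by
    refine not_le.1 fun hle => ?_
    have hUV : U a b n < U a b (tau a b (V a b n)) :=
      (U_lt_V ha hΔ hb hn).trans_le (Int.le_of_dvd (U_pos ha hΔ hpos) (dvd_U_tau hpos))
    rcases hle.lt_or_eq with hτn | heq
    · exact (hUV.trans (U_lt_U ha hΔ hb hpos hτn hn)).false
    · exact (heq ▸ hUV).false
  have hdvd := (dvd_U_iff_tau_dvd hab hpos _).1 (V_dvd_U_two_mul a b n)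
  exact (Nat.eq_of_dvd_of_lt_two_mul (by omega) hdvd (by omega)).symm

/-- The greatest common divisor of `A`, `B` and the two quotients `W / A`, `W / B`, where
`W = U_L` is the term at the least common multiple `L` of the orders of appearance of `A` and `B`.
It measures by how much `τ(AB)` falls short of `L · gcd(A, B)`. The quotients are exact as soon as
both orders exist. -/
noncomputable def tauDefect (a b A B : ℤ) : ℕ :=
  Int.gcd (Int.gcd A B) (Int.gcd (U a b ((tau a b A).lcm (tau a b B)) / A)
    (U a b ((tau a b A).lcm (tau a b B)) / B))

lemma tauDefect_eq {A B x y : ℤ} (hA : A ≠ 0) (hB : B ≠ 0)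
    (hx : U a b ((tau a b A).lcm (tau a b B)) = A * x)
    (hy : U a b ((tau a b A).lcm (tau a b B)) = B * y) :
    tauDefect a b A B = Int.gcd (Int.gcd A B) (Int.gcd x y) := by
  rw [tauDefect, Int.ediv_eq_of_eq_mul_right hA hx, Int.ediv_eq_of_eq_mul_right hB hy]

lemma dvd_tauDefect_iff {A B x y : ℤ} (hA : A ≠ 0) (hB : B ≠ 0)
    (hx : U a b ((tau a b A).lcm (tau a b B)) = A * x)
    (hy : U a b ((tau a b A).lcm (tau a b B)) = B * y) {k : ℕ} :
    k ∣ tauDefect a b A B ↔ ((k : ℤ) ∣ A ∧ (k : ℤ) ∣ B) ∧ (k : ℤ) ∣ x ∧ (k : ℤ) ∣ y := by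
  rw [tauDefect_eq hA hB hx hy, Int.dvd_gcd_iff, Int.dvd_coe_gcd_iff, Int.dvd_coe_gcd_iff]

lemma tauDefect_dvd_gcd (A B : ℤ) : tauDefect a b A B ∣ Int.gcd A B :=
  Int.gcd_dvd_natAbs_left _ _

lemma mul_dvd_U_iff (hab : IsCoprime a b) {A B : ℤ} (hA : 0 < tau a b A) (hB : 0 < tau a b B)
    (hW : U a b ((tau a b A).lcm (tau a b B)) ≠ 0) (k : ℕ) :
    A * B ∣ U a b k ↔
      (tau a b A).lcm (tau a b B) * (Int.gcd A B / tauDefect a b A B) ∣ k := by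
  obtain ⟨x, hx⟩ := (dvd_U_iff_tau_dvd hab hA _).2 (Nat.dvd_lcm_left _ (tau a b B))
  obtain ⟨y, hy⟩ := (dvd_U_iff_tau_dvd hab hB _).2 (Nat.dvd_lcm_right (tau a b A) _)
  have hL : 0 < (tau a b A).lcm (tau a b B) := Nat.lcm_pos hA hB
  have hA0 : A ≠ 0 := left_ne_zero_of_mul (hx ▸ hW)
  have hB0 : B ≠ 0 := left_ne_zero_of_mul (hy ▸ hW)
  by_cases hk : (tau a b A).lcm (tau a b B) ∣ k
  · obtain ⟨t, rfl⟩ := hk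
    have hquot : ((Int.gcd A B / tauDefect a b A B : ℕ) : ℤ) ∣
        U a b ((tau a b A).lcm (tau a b B)) :=
      (Int.natCast_dvd_natCast.2 (Nat.div_dvd_of_dvd (tauDefect_dvd_gcd A B))).trans
        ((Int.gcd_dvd_left ..).trans ⟨x, hx⟩)
    rw [U_mul, mul_dvd_mul_iff_div_gcd_dvd hW hx hy, ← tauDefect_eq hA0 hB0 hx hy,
      dvd_UQuot_iff hab hquot, Int.natCast_dvd_natCast, Nat.mul_dvd_mul_iff_left hL]
  · exact iff_of_false (mt (lcm_tau_dvd_of_mul_dvd hab hA hB) hk) (mt dvd_of_mul_right_dvd hk)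

theorem tau_mul_mul_tauDefect (hab : IsCoprime a b) {A B : ℤ} (hA : 0 < tau a b A)
    (hB : 0 < tau a b B) (hW : U a b ((tau a b A).lcm (tau a b B)) ≠ 0) :
    tau a b (A * B) * tauDefect a b A B = (tau a b A).lcm (tau a b B) * Int.gcd A B := by
  have hgcd : 0 < Int.gcd A B := Int.gcd_pos_of_ne_zero_left _ fun h => hW
    (zero_dvd_iff.1 (h ▸ (dvd_U_iff_tau_dvd hab hA _).2 (Nat.dvd_lcm_left _ (tau a b B))))
  have hdvd := tauDefect_dvd_gcd (a := a) (b := b) A B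
  have hquot := Nat.div_pos (Nat.le_of_dvd hgcd hdvd) (Nat.pos_of_dvd_of_pos hdvd hgcd)
  rw [tau_eq_of_forall_dvd_iff (Nat.mul_pos (Nat.lcm_pos hA hB) hquot) (mul_dvd_U_iff hab hA hB hW),
    mul_assoc, Nat.div_mul_cancel hdvd]

lemma tau_mul_of_mul_dvd (hab : IsCoprime a b) {A B : ℤ} (hA : 0 < tau a b A)
    (hB : 0 < tau a b B) (h : A * B ∣ U a b ((tau a b A).lcm (tau a b B))) :
    tau a b (A * B) = (tau a b A).lcm (tau a b B) :=
  tau_eq_of_forall_dvd_iff (Nat.lcm_pos hA hB) fun _ =>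
    ⟨lcm_tau_dvd_of_mul_dvd hab hA hB, fun hk => h.trans (U_dvd_U_of_dvd a b hk)⟩

end OrderOfAppearance

section Products

lemma U_lcm_tau_ne_zero (ha : 0 < a) (hΔ : 0 < a ^ 2 + 4 * b) {A B : ℤ} (hA : 0 < tau a b A)
    (hB : 0 < tau a b B) : U a b ((tau a b A).lcm (tau a b B)) ≠ 0 :=
  (U_pos ha hΔ (Nat.lcm_pos hA hB)).ne'

lemma tauDefect_U_U_eq_one (hab : IsCoprime a b) (ha : 0 < a) (hΔ : 0 < a ^ 2 + 4 * b) (hb : b ≠ 0)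
    {m n : ℕ} (hm : 3 ≤ m) (hn : 3 ≤ n) : tauDefect a b (U a b m) (U a b n) = 1 := by
  have hm0 : 0 < m := by omega
  have hn0 : 0 < n := by omega
  have hτm := tau_U ha hΔ hb hm
  have hτn := tau_U ha hΔ hb hn
  have hx : U a b ((tau a b (U a b m)).lcm (tau a b (U a b n))) =
      U a b m * UQuot a b m (m.lcm n / m) := by
    rw [hτm, hτn, ← U_mul, Nat.mul_div_cancel' (Nat.dvd_lcm_left m n)]
  have hy : U a b ((tau a b (U a b m)).lcm (tau a b (U a b n))) =
      U a b n * UQuot a b n (m.lcm n / n) := by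
    rw [hτm, hτn, ← U_mul, Nat.mul_div_cancel' (Nat.dvd_lcm_right m n)]
  obtain ⟨⟨hDm, hDn⟩, hDx, hDy⟩ :=
    (dvd_tauDefect_iff (U_pos ha hΔ hm0).ne' (U_pos ha hΔ hn0).ne' hx hy).1 dvd_rfl
  rw [dvd_UQuot_iff hab hDm, Int.natCast_dvd_natCast] at hDx
  rw [dvd_UQuot_iff hab hDn, Int.natCast_dvd_natCast] at hDy
  exact Nat.eq_one_of_dvd_coprimes (coprime_lcm_div_lcm_div hm0 hn0) hDx hDy

theorem tau_U_mul_U (hab : IsCoprime a b) (ha : 0 < a) (hΔ : 0 < a ^ 2 + 4 * b) (hb : b ≠ 0)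
    {m n : ℕ} (hm : 3 ≤ m) (hn : 3 ≤ n) :
    (tau a b (U a b m * U a b n) : ℤ) = m.lcm n * U a b (m.gcd n) := by
  have hm0 : 0 < m := by omega
  have hn0 : 0 < n := by omega
  have hτm_pos := tau_U_pos a b hm0
  have hτn_pos := tau_U_pos a b hn0
  have key := tau_mul_mul_tauDefect hab hτm_pos hτn_pos (U_lcm_tau_ne_zero ha hΔ hτm_pos hτn_pos)
  rw [tauDefect_U_U_eq_one hab ha hΔ hb hm hn, mul_one, tau_U ha hΔ hb hm, tau_U ha hΔ hb hn,
    gcd_U_U hab] at key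
  rw [key, Nat.cast_mul, Int.natAbs_of_nonneg (U_pos ha hΔ (Nat.gcd_pos_of_pos_left n hm0)).le]

theorem tau_U_mul_V_of_le (hab : IsCoprime a b) (ha : 0 < a) (hΔ : 0 < a ^ 2 + 4 * b) (hb : b ≠ 0)
    {m n : ℕ} (hm : 3 ≤ m) (hn : 3 ≤ n)
    (h : padicValNat 2 m ≤ padicValNat 2 n) :
    tau a b (U a b m * V a b n) = 2 * m.lcm n := by
  have hm0 : 0 < m := by omega
  have hn0 : 0 < n := by omega
  have hlcm : (tau a b (U a b m)).lcm (tau a b (V a b n)) = 2 * m.lcm n := by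
    rw [tau_U ha hΔ hb hm, tau_V hab ha hΔ hb hn, lcm_two_mul_of_padicValNat_le hm0 hn0 h]
  have hdvd : U a b m * V a b n ∣ U a b ((tau a b (U a b m)).lcm (tau a b (V a b n))) := by
    rw [hlcm, U_two_mul]
    exact mul_dvd_mul (U_dvd_U_of_dvd a b (Nat.dvd_lcm_left m n))
      (V_dvd_V_of_padicValNat_le hab hm0 hn0 h)
  rw [tau_mul_of_mul_dvd hab (tau_U_pos a b hm0) (tau_V_pos a b hn0) hdvd, hlcm]

lemma tauDefect_U_V_eq_one (hab : IsCoprime a b) (ha : 0 < a) (hΔ : 0 < a ^ 2 + 4 * b) (hb : b ≠ 0)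
    {m n : ℕ} (hm : 3 ≤ m) (hn : 3 ≤ n) (h : padicValNat 2 n < padicValNat 2 m) :
    tauDefect a b (U a b m) (V a b n) = 1 := by
  have hm0 : 0 < m := by omega
  have hn0 : 0 < n := by omega
  have hlcm2 := lcm_two_mul_of_padicValNat_lt hm0 hn0 h
  have hlcm : (tau a b (U a b m)).lcm (tau a b (V a b n)) = m.lcm n := by
    rw [tau_U ha hΔ hb hm, tau_V hab ha hΔ hb hn, hlcm2]
  obtain ⟨t, ht⟩ : 2 * n ∣ m.lcm n := hlcm2 ▸ Nat.dvd_lcm_right m (2 * n)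
  have htn : 2 * t = m.lcm n / n := (Nat.div_eq_of_eq_mul_right hn0 (by rw [ht]; ring)).symm
  have hx : U a b ((tau a b (U a b m)).lcm (tau a b (V a b n))) =
      U a b m * UQuot a b m (m.lcm n / m) := by
    rw [hlcm, ← U_mul, Nat.mul_div_cancel' (Nat.dvd_lcm_left m n)]
  have hy : U a b ((tau a b (U a b m)).lcm (tau a b (V a b n))) =
      V a b n * (U a b n * UQuot a b (2 * n) t) := by
    rw [hlcm, ht, U_two_mul_mul]
  obtain ⟨⟨hDU, hDV⟩, hDx, hDy⟩ :=
    (dvd_tauDefect_iff (U_pos ha hΔ hm0).ne' (V_pos ha hΔ n).ne' hx hy).1 dvd_rfl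
  rw [dvd_UQuot_iff hab hDU, Int.natCast_dvd_natCast] at hDx
  rw [dvd_mul_UQuot_iff hab (hDV.trans (V_dvd_U_two_mul a b n))] at hDy
  have hD2t : tauDefect a b (U a b m) (V a b n) ∣ 2 * t := by
    exact_mod_cast dvd_two_mul_of_dvd_V hab hDV hDy
  exact Nat.eq_one_of_dvd_coprimes (coprime_lcm_div_lcm_div hm0 hn0) hDx (htn ▸ hD2t)

theorem tau_U_mul_V_of_lt (hab : IsCoprime a b) (ha : 0 < a) (hΔ : 0 < a ^ 2 + 4 * b) (hb : b ≠ 0)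
    {m n : ℕ} (hm : 3 ≤ m) (hn : 3 ≤ n)
    (h : padicValNat 2 n < padicValNat 2 m) :
    (tau a b (U a b m * V a b n) : ℤ) = m.lcm n * V a b (m.gcd n) := by
  have hm0 : 0 < m := by omega
  have hn0 : 0 < n := by omega
  have hτm_pos := tau_U_pos a b hm0
  have hτn_pos := tau_V_pos a b hn0
  have key := tau_mul_mul_tauDefect hab hτm_pos hτn_pos (U_lcm_tau_ne_zero ha hΔ hτm_pos hτn_pos)
  rw [tauDefect_U_V_eq_one hab ha hΔ hb hm hn h, mul_one, tau_U ha hΔ hb hm,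
    tau_V hab ha hΔ hb hn, lcm_two_mul_of_padicValNat_lt hm0 hn0 h,
    gcd_U_V_of_padicValNat_lt hab hm0 hn0 h] at key
  rw [key, Nat.cast_mul, Int.natAbs_of_nonneg (V_pos ha hΔ _).le]

lemma dvd_tauDefect_V_V_iff (hab : IsCoprime a b) (ha : 0 < a) (hΔ : 0 < a ^ 2 + 4 * b) (hb : b ≠ 0)
    {m n : ℕ} (hm : 3 ≤ m) (hn : 3 ≤ n) (k : ℕ) :
    k ∣ tauDefect a b (V a b m) (V a b n) ↔ ((k : ℤ) ∣ V a b m ∧ (k : ℤ) ∣ V a b n) ∧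
      (k : ℤ) ∣ U a b m * (m.lcm n / m : ℕ) ∧ (k : ℤ) ∣ U a b n * (m.lcm n / n : ℕ) := by
  have hτm := tau_V hab ha hΔ hb hm
  have hτn := tau_V hab ha hΔ hb hn
  have hx : U a b ((tau a b (V a b m)).lcm (tau a b (V a b n))) =
      V a b m * (U a b m * UQuot a b (2 * m) (m.lcm n / m)) := by
    rw [hτm, hτn, ← U_two_mul_mul, Nat.lcm_mul_left, mul_assoc,
      Nat.mul_div_cancel' (Nat.dvd_lcm_left m n)]
  have hy : U a b ((tau a b (V a b m)).lcm (tau a b (V a b n))) =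
      V a b n * (U a b n * UQuot a b (2 * n) (m.lcm n / n)) := by
    rw [hτm, hτn, ← U_two_mul_mul, Nat.lcm_mul_left, mul_assoc,
      Nat.mul_div_cancel' (Nat.dvd_lcm_right m n)]
  rw [dvd_tauDefect_iff (V_pos ha hΔ m).ne' (V_pos ha hΔ n).ne' hx hy]
  refine and_congr_right fun ⟨hkm, hkn⟩ => ?_
  rw [dvd_mul_UQuot_iff hab (hkm.trans (V_dvd_U_two_mul a b m)),
    dvd_mul_UQuot_iff hab (hkn.trans (V_dvd_U_two_mul a b n))]

lemma tauDefect_V_V_dvd_two (hab : IsCoprime a b) (ha : 0 < a) (hΔ : 0 < a ^ 2 + 4 * b) (hb : b ≠ 0)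
    {m n : ℕ} (hm : 3 ≤ m) (hn : 3 ≤ n) :
    tauDefect a b (V a b m) (V a b n) ∣ 2 := by
  obtain ⟨⟨hDm, hDn⟩, hDx, hDy⟩ := (dvd_tauDefect_V_V_iff hab ha hΔ hb hm hn _).1 dvd_rfl
  have h1 : tauDefect a b (V a b m) (V a b n) ∣ 2 * (m.lcm n / m) := by
    exact_mod_cast dvd_two_mul_of_dvd_V hab hDm hDx
  have h2 : tauDefect a b (V a b m) (V a b n) ∣ 2 * (m.lcm n / n) := by
    exact_mod_cast dvd_two_mul_of_dvd_V hab hDn hDy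
  have hcop := coprime_lcm_div_lcm_div (m := m) (n := n) (by omega) (by omega)
  simpa only [Nat.gcd_mul_left, hcop.gcd_eq_one, mul_one] using Nat.dvd_gcd h1 h2

lemma two_dvd_V_iff_of_not_two_dvd (ha : ¬ 2 ∣ a) (k : ℕ) : 2 ∣ V a b k ↔ 2 ∣ U a b k := by
  rw [V_eq, dvd_sub_right (dvd_mul_right _ _), Int.prime_two.dvd_mul, or_iff_right ha]

lemma two_dvd_V_of_two_dvd (ha : 2 ∣ a) (k : ℕ) : 2 ∣ V a b k := by
  rw [V_eq]
  exact dvd_sub (dvd_mul_right _ _) (ha.mul_right _)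

lemma two_dvd_U_iff_of_two_dvd (hab : IsCoprime a b) (ha : 2 ∣ a) (k : ℕ) :
    2 ∣ U a b k ↔ 2 ∣ k :=
  dvd_U_iff_prime_dvd hab Int.prime_two.not_isUnit Nat.prime_two (by simpa [U] using ha) k

lemma two_dvd_U_iff_of_not_two_dvd (hab : IsCoprime a b) (ha : ¬ 2 ∣ a) {k : ℕ} (hk : 0 < k) :
    2 ∣ U a b k ↔ ¬ 2 ∣ b ∧ 3 ∣ k := by
  by_cases hb : 2 ∣ b
  · refine iff_of_false (fun hU => ?_) (fun h => h.1 hb)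
    exact Int.prime_two.not_isUnit ((isCoprime_U_right hab hk).isUnit_of_dvd' hU hb)
  · have hU3 : 2 ∣ U a b 3 := by
      rw [Int.two_dvd_ne_zero, ← Int.odd_iff] at ha hb
      have hsum : Even (a * a + b) := (ha.mul ha).add_odd hb
      simpa [U] using hsum.two_dvd
    rw [dvd_U_iff_prime_dvd hab Int.prime_two.not_isUnit Nat.prime_three hU3, and_iff_right hb]

lemma two_dvd_tauDefect_V_V_iff (hab : IsCoprime a b) (ha : 0 < a) (hΔ : 0 < a ^ 2 + 4 * b)
    (hb : b ≠ 0) {m n : ℕ} (hm : 3 ≤ m) (hn : 3 ≤ n) :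
    2 ∣ tauDefect a b (V a b m) (V a b n) ↔
      ¬ 2 ∣ b ∧ (2 ∣ a ∧ 2 ∣ m.lcm n ∨ ¬ 2 ∣ a ∧ 3 ∣ m.gcd n) := by
  rw [dvd_tauDefect_V_V_iff hab ha hΔ hb hm hn, Nat.cast_ofNat]
  by_cases h2a : 2 ∣ a
  · have h2b : ¬ 2 ∣ b := fun h2b => Int.prime_two.not_isUnit (hab.isUnit_of_dvd' h2a h2b)
    have hm2 : 2 ∣ m ∨ 2 ∣ m.lcm n / m ↔ 2 ∣ m.lcm n := by
      rw [← Nat.prime_two.dvd_mul, Nat.mul_div_cancel' (Nat.dvd_lcm_left m n)]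
    have hn2 : 2 ∣ n ∨ 2 ∣ m.lcm n / n ↔ 2 ∣ m.lcm n := by
      rw [← Nat.prime_two.dvd_mul, Nat.mul_div_cancel' (Nat.dvd_lcm_right m n)]
    have hcast : ∀ k : ℕ, (2 : ℤ) ∣ k ↔ 2 ∣ k := fun k => by omega
    simp only [Int.prime_two.dvd_mul, two_dvd_V_of_two_dvd h2a,
      two_dvd_U_iff_of_two_dvd hab h2a, hcast, hm2, hn2, h2a, h2b, and_self, not_false_eq_true,
      not_true_eq_false, true_and, false_and, or_false]
  · rw [two_dvd_V_iff_of_not_two_dvd h2a, two_dvd_V_iff_of_not_two_dvd h2a,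
      and_iff_left_of_imp fun h => ⟨h.1.mul_right _, h.2.mul_right _⟩, ← dvd_U_gcd_iff hab,
      two_dvd_U_iff_of_not_two_dvd hab h2a (Nat.gcd_pos_of_pos_left n (by omega))]
    simp only [h2a, false_and, false_or, not_false_eq_true, true_and]

lemma tau_V_mul_V_mul_tauDefect (hab : IsCoprime a b) (ha : 0 < a) (hΔ : 0 < a ^ 2 + 4 * b)
    (hb : b ≠ 0) {m n : ℕ} (hm : 3 ≤ m) (hn : 3 ≤ n) :
    tau a b (V a b m * V a b n) * tauDefect a b (V a b m) (V a b n) =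
      2 * m.lcm n * Int.gcd (V a b m) (V a b n) := by
  have hτm_pos := tau_V_pos a b (n := m) (by omega)
  have hτn_pos := tau_V_pos a b (n := n) (by omega)
  have hτm := tau_V hab ha hΔ hb hm
  have hτn := tau_V hab ha hΔ hb hn
  rw [tau_mul_mul_tauDefect hab hτm_pos hτn_pos
    (U_lcm_tau_ne_zero ha hΔ hτm_pos hτn_pos), hτm, hτn, Nat.lcm_mul_left]

theorem tau_V_mul_V_of_two_dvd_tauDefect (hab : IsCoprime a b) (ha : 0 < a) (hΔ : 0 < a ^ 2 + 4 * b)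
    (hb : b ≠ 0) {m n : ℕ} (hm : 3 ≤ m) (hn : 3 ≤ n)
    (h : 2 ∣ tauDefect a b (V a b m) (V a b n)) :
    tau a b (V a b m * V a b n) = m.lcm n * Int.gcd (V a b m) (V a b n) := by
  have key := tau_V_mul_V_mul_tauDefect hab ha hΔ hb hm hn
  rw [(tauDefect_V_V_dvd_two hab ha hΔ hb hm hn).antisymm h] at key
  linarith

theorem tau_V_mul_V_of_not_two_dvd_tauDefect (hab : IsCoprime a b) (ha : 0 < a)
    (hΔ : 0 < a ^ 2 + 4 * b) (hb : b ≠ 0) {m n : ℕ} (hm : 3 ≤ m) (hn : 3 ≤ n)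
    (h : ¬ 2 ∣ tauDefect a b (V a b m) (V a b n)) :
    tau a b (V a b m * V a b n) = 2 * m.lcm n * Int.gcd (V a b m) (V a b n) := by
  have key := tau_V_mul_V_mul_tauDefect hab ha hΔ hb hm hn
  obtain h1 | h2 := (Nat.dvd_prime Nat.prime_two).1 (tauDefect_V_V_dvd_two hab ha hΔ hb hm hn)
  · rwa [h1, mul_one] at key
  · exact absurd h2.symm.dvd h

end Products

end LucasPair

theorem theorem1p1 (a b : ℤ) (hab : IsCoprime a b) (hnd : LucasPair.Nondegenerate a b)
    (ha : 0 < a) (hΔ : 0 < a ^ 2 + 4 * b) (m n : ℕ) (hm : 3 ≤ m) (hn : 3 ≤ n)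
    (d : ℕ) (hd : d = Nat.gcd m n) :
    -- (i)
    (LucasPair.Admissible b (LucasPair.U a b m * LucasPair.V a b n) ∧
      (padicValNat 2 m ≤ padicValNat 2 n →
        (LucasPair.tau a b (LucasPair.U a b m * LucasPair.V a b n) : ℤ) =
          2 * (Nat.lcm m n : ℤ)) ∧
      (padicValNat 2 n < padicValNat 2 m →
        (LucasPair.tau a b (LucasPair.U a b m * LucasPair.V a b n) : ℤ) =
          (Nat.lcm m n : ℤ) * LucasPair.V a b d)) ∧
    -- (ii)
    (LucasPair.Admissible b (LucasPair.U a b m * LucasPair.U a b n) ∧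
      (LucasPair.tau a b (LucasPair.U a b m * LucasPair.U a b n) : ℤ) =
        (Nat.lcm m n : ℤ) * LucasPair.U a b d) ∧
    -- (iii)
    (LucasPair.Admissible b (LucasPair.V a b m * LucasPair.V a b n) ∧
      ((¬ 2 ∣ b ∧ 2 ∣ a ∧ 2 ∣ d) ∨ (¬ 2 ∣ b ∧ ¬ 2 ∣ a ∧ 3 ∣ d) ∨
          (¬ 2 ∣ b ∧ 2 ∣ a ∧ ¬ 2 ∣ d ∧ padicValNat 2 m ≠ padicValNat 2 n) →
        LucasPair.tau a b (LucasPair.V a b m * LucasPair.V a b n) =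
          Nat.lcm m n * Int.gcd (LucasPair.V a b m) (LucasPair.V a b n)) ∧
      (2 ∣ b ∨ (¬ 2 ∣ b ∧ ¬ 2 ∣ a ∧ ¬ 3 ∣ d) ∨
          (¬ 2 ∣ b ∧ 2 ∣ a ∧ ¬ 2 ∣ d ∧ padicValNat 2 m = padicValNat 2 n) →
        LucasPair.tau a b (LucasPair.V a b m * LucasPair.V a b n) =
          2 * Nat.lcm m n * Int.gcd (LucasPair.V a b m) (LucasPair.V a b n))) := by
  subst hd
  obtain ⟨hb, -⟩ := hnd
  have hUm := LucasPair.admissible_U hab ha hΔ (n := m) (by omega)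
  have hUn := LucasPair.admissible_U hab ha hΔ (n := n) (by omega)
  have hVm := LucasPair.admissible_V hab ha hΔ (n := m) (by omega)
  have hVn := LucasPair.admissible_V hab ha hΔ (n := n) (by omega)
  have hlcm := LucasPair.prime_dvd_lcm_iff (p := 2) (m := m) (n := n) (by omega) (by omega)
  have hcop : ¬ (2 ∣ a ∧ 2 ∣ b) := fun h => Int.prime_two.not_isUnit (hab.isUnit_of_dvd' h.1 h.2)
  have hdefect := LucasPair.two_dvd_tauDefect_V_V_iff hab ha hΔ hb hm hn
  refine ⟨⟨hUm.mul hVn, fun h => ?_, LucasPair.tau_U_mul_V_of_lt hab ha hΔ hb hm hn⟩,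
    ⟨hUm.mul hUn, LucasPair.tau_U_mul_U hab ha hΔ hb hm hn⟩, hVm.mul hVn,
    fun h => LucasPair.tau_V_mul_V_of_two_dvd_tauDefect hab ha hΔ hb hm hn ?_,
    fun h => LucasPair.tau_V_mul_V_of_not_two_dvd_tauDefect hab ha hΔ hb hm hn ?_⟩
  · exact_mod_cast LucasPair.tau_U_mul_V_of_le hab ha hΔ hb hm hn h
  · rw [hdefect]; tauto
  · rw [hdefect]; tauto
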